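/- Let $k>0$, $0<c<\infty$ and let $p$ be a real number with $p/k\ge 1$. Let $\{\xi_n\}_{n\ge1}$ be a sequence of i.i.d. real random variables with $\mathbb{E}|\xi_1|^k<\infty$ and $$\lim_{u\to\infty}u^{-p}\log\mathbb{P}\{|\xi_1|\ge u\}=-c.$$ Let $q\in(1,\infty]$ be given by $\frac{1}{p/k}+\frac1q=1$ (so $q=\infty$ if $p=k$), and write $2\wedge q=\min\{2,q\}$, $\|a\|_q=\left(\sum_{n=1}^\infty |a_n|^q\right)^{1/q}$ if $q<\infty$, and $\|a\|_\infty=\sup_n|a_n|$. Let $\{a_n\}$, $\{b_n\}$ be two sequences of positive real numbers such that $\sum_{n=1}^\infty a_n^{2\wedge q}<\infty$ and $\sum_{n=1}^\infty b_n^{2\wedge q}<\infty$, and such that the random series $\sum_{n=1}^\infty a_n|\xi_n|^k$ and $\sum_{n=1}^\infty b_n|\xi_n|^k$ converge almost surely. Then $$\lim_{r\to\infty}\frac{\log\mathbb{P}\left\{\sum_{n=1}^{\infty}a_n|\xi_n|^k\geq r\right\}}{\log\mathbb{P}\left\{\sum_{n=1}^{\infty}b_n|\xi_n|^k\geq r\right\}}=\left(\frac{\|b\|_q}{\|a\|_q}\right)^{p/k}$$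 and $$\lim_{r\to\infty}\frac{\log\mathbb{P}\left\{\sum_{n=1}^{\infty}a_n|\xi_n|^k\geq r\|a\|_q\right\}}{\log\mathbb{P}\left\{\sum_{n=1}^{\infty}b_n|\xi_n|^k\geq r\|b\|_q\right\}}=1.$$ -/

import Mathlib

open MeasureTheory ProbabilityTheory Filter Topology
open scoped ENNReal

/-- The `l^q` norm of a real sequence, `1 ≤ q ≤ ∞`: it is `(∑ |a_n|^q)^(1/q)` for finite `q` and
`sup |a_n|` for `q = ∞`. -/
noncomputable def lqNorm (q : ℝ≥0∞) (a : ℕ → ℝ) : ℝ :=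
  if q = ∞ then ⨆ n, |a n| else (∑' n, |a n| ^ q.toReal) ^ (1 / q.toReal)

/-! Put `Y n = |ξ n| ^ k` and `s = p / k`, so that `P(Y ≥ u)` decays like `exp (-c u ^ s)` on the
logarithmic scale. Both limits follow from one asymptotic relation: `log P(∑ a n * Y n ≥ r)` is
equivalent to `-c (r / ‖a‖_q) ^ s`. The rate is the cheapest way to make the sum large: the minimum
of `c ∑ w n ^ s` subject to `∑ a n * w n = 1` is `c / ‖a‖_q ^ s` by Hölder.

For the lower bound, independence prices the event that `Y n ≥ r * w n` for finitely many `n`, with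
`w` nearly optimal (`eventually_lt_log_measureReal_tsum_ge`, `exists_weights_sum_rpow_lt`). The
upper bound is Chernoff's (`measureReal_tsum_ge_le_exp`). For `s > 1`, Young's inequality bounds the
cumulant generating function by a Legendre transform plus a term `K t`, which costs only `O(r ^ (s -
1))` provided `∑ a n` is finite. That summability comes from almost sure convergence
(`summable_coeff_of_ae_summable`); the condition on the powers of `a` serves only to bound `a`. -/

/-! ### Exponential moments and Laplace transforms -/

/-- A nonnegative variable with tails `O(exp (-θ' v))` has exponential moments of every order
`θ < θ'`. -/
theorem integrable_exp_mul_of_tail_le {Ω : Type*} [MeasurableSpace Ω] (μ : Measure Ω)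
    [IsProbabilityMeasure μ] {Z : Ω → ℝ} (hZ : Measurable Z) (hZ0 : ∀ ω, 0 ≤ Z ω) {θ θ' : ℝ}
    (hθ : 0 ≤ θ) (hlt : θ < θ')
    (htail : ∀ᶠ v : ℝ in atTop, μ.real {ω | v ≤ Z ω} ≤ Real.exp (-θ' * v)) :
    Integrable (fun ω => Real.exp (θ * Z ω)) μ := by
  have hms : ∀ n : ℕ, MeasurableSet {ω | (n : ℝ) ≤ Z ω} := fun n =>
    measurableSet_le measurable_const hZ
  have hsum : Summable (fun n : ℕ => Real.exp (θ * (n + 1)) * μ.real {ω | (n : ℝ) ≤ Z ω}) := by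
    have hg : Summable (fun n : ℕ => Real.exp θ * Real.exp (-(θ' - θ)) ^ n) := by
      refine (summable_geometric_of_lt_one (Real.exp_pos _).le ?_).mul_left _
      rw [Real.exp_lt_one_iff]
      linarith
    refine Summable.of_norm_bounded_eventually_nat hg ?_
    filter_upwards [tendsto_natCast_atTop_atTop.eventually htail] with n hn
    rw [Real.norm_of_nonneg (by positivity)]
    calc _ ≤ Real.exp (θ * (n + 1)) * Real.exp (-θ' * n) := by gcongr
      _ = _ := by
        rw [← Real.exp_nat_mul, ← Real.exp_add, ← Real.exp_add]
        congr 1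
        ring
  refine ⟨(hZ.const_mul θ).exp.aestronglyMeasurable, ?_⟩
  rw [hasFiniteIntegral_iff_ofReal (ae_of_all _ fun ω => (Real.exp_pos _).le)]
  calc ∫⁻ ω, ENNReal.ofReal (Real.exp (θ * Z ω)) ∂μ
      ≤ ∫⁻ ω, ∑' n : ℕ, {ω | (n : ℝ) ≤ Z ω}.indicator
          (fun _ => ENNReal.ofReal (Real.exp (θ * (n + 1)))) ω ∂μ := by
        refine lintegral_mono fun ω => ?_
        -- The single term `n = ⌊Z ω⌋₊` already dominates, since `Z ω < n + 1`.
        refine le_trans ?_ (ENNReal.le_tsum ⌊Z ω⌋₊)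
        rw [Set.indicator_of_mem (by exact Nat.floor_le (hZ0 ω))]
        gcongr
        exact (Nat.lt_floor_add_one _).le
    _ = ∑' n : ℕ, ENNReal.ofReal (Real.exp (θ * (n + 1)) * μ.real {ω | (n : ℝ) ≤ Z ω}) := by
        rw [lintegral_tsum fun n => (measurable_const.indicator (hms n)).aemeasurable]
        congr 1
        ext1 n
        rw [lintegral_indicator_const (hms n), ENNReal.ofReal_mul (Real.exp_pos _).le,
          ofReal_measureReal]
    _ < ⊤ := hsum.tsum_ofReal_lt_top

/-- The Laplace transform of a nonnegative variable that exceeds `δ` with probability `ρ`. -/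
theorem mgf_neg_le_of_measureReal {Ω : Type*} [MeasurableSpace Ω] (μ : Measure Ω)
    [IsProbabilityMeasure μ] {Y : Ω → ℝ} (hY : Measurable Y) (hY0 : ∀ ω, 0 ≤ Y ω) (δ t : ℝ)
    (hδ : 0 ≤ δ) (ht : 0 ≤ t) :
    mgf Y μ (-t) ≤ Real.exp (-(μ.real {ω | δ ≤ Y ω} * (t * δ / (1 + t * δ)))) := by
  have hms : MeasurableSet {ω | δ ≤ Y ω} := measurableSet_le measurable_const hY
  have hx : 0 ≤ t * δ := by positivity
  -- A rational lower bound for `1 - exp (-t δ)`, comparable to `t` on bounded ranges of `t`.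
  set x := t * δ / (1 + t * δ) with hxdef
  have hexp : Real.exp (-(t * δ)) ≤ 1 - x := by
    have h1 : 1 - x = (1 + t * δ)⁻¹ := by
      rw [hxdef]
      field_simp
      ring
    rw [h1, Real.exp_neg]
    gcongr
    linarith [Real.add_one_le_exp (t * δ)]
  have hint : Integrable (fun ω => 1 - {ω | δ ≤ Y ω}.indicator (fun _ => x) ω) μ :=
    (integrable_const _).sub ((integrable_const _).indicator hms)
  calc mgf Y μ (-t) ≤ ∫ ω, (1 - {ω | δ ≤ Y ω}.indicator (fun _ => x) ω) ∂μ := by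
        refine integral_mono_of_nonneg (ae_of_all _ fun ω => (Real.exp_pos _).le) hint
          (ae_of_all _ fun ω => ?_)
        beta_reduce
        by_cases h : δ ≤ Y ω
        · rw [Set.indicator_of_mem (by exact h)]
          refine le_trans (Real.exp_le_exp.2 ?_) hexp
          nlinarith
        · rw [Set.indicator_of_notMem (by exact h), sub_zero]
          refine Real.exp_le_one_iff.2 ?_
          nlinarith [hY0 ω, mul_nonneg ht (hY0 ω)]
    _ = 1 - μ.real {ω | δ ≤ Y ω} * x := by
        rw [integral_sub (integrable_const _) ((integrable_const _).indicator hms),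
          integral_indicator_const _ hms]
        simp
    _ ≤ _ := by linarith [Real.add_one_le_exp (-(μ.real {ω | δ ≤ Y ω} * x))]

/-- The moment generating function of a finite weighted sum of i.i.d. variables. -/
theorem mgf_weighted_sum_of_iid {Ω : Type*} [MeasurableSpace Ω] (μ : Measure Ω)
    [IsProbabilityMeasure μ] {Y : ℕ → Ω → ℝ} (hY : ∀ n, Measurable (Y n)) (hind : iIndepFun Y μ)
    (hid : ∀ n, IdentDistrib (Y n) (Y 0) μ μ) (a : ℕ → ℝ) (F : Finset ℕ) (t : ℝ) :
    mgf (fun ω => ∑ n ∈ F, a n * Y n ω) μ t = ∏ n ∈ F, mgf (Y 0) μ (t * a n) := by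
  have h1 : iIndepFun (fun n ω => a n * Y n ω) μ :=
    hind.comp (fun n x => a n * x) fun n => measurable_id.const_mul _
  have h2 := h1.mgf_sum (t := t) (fun n => (hY n).const_mul _) F
  have h3 : (∑ n ∈ F, fun ω => a n * Y n ω) = fun ω => ∑ n ∈ F, a n * Y n ω := by
    ext ω
    simp
  rw [h3] at h2
  rw [h2]
  refine Finset.prod_congr rfl fun n _ => ?_
  rw [mgf_const_mul, mgf_congr_of_identDistrib _ _ (hid n), mul_comm]

/-! ### Summability of the coefficients -/

/-- If a random series `∑ a n * Y n` with i.i.d. nonnegative nonzero `Y n` and bounded positive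
coefficients converges almost surely, then the coefficients are summable. -/
theorem summable_coeff_of_ae_summable {Ω : Type*} [MeasurableSpace Ω] (μ : Measure Ω)
    [IsProbabilityMeasure μ] {Y : ℕ → Ω → ℝ} (hY : ∀ n, Measurable (Y n))
    (hY0 : ∀ n ω, 0 ≤ Y n ω) (hind : iIndepFun Y μ) (hid : ∀ n, IdentDistrib (Y n) (Y 0) μ μ)
    {a : ℕ → ℝ} (ha : ∀ n, 0 ≤ a n) {B : ℝ} (hB : ∀ n, a n ≤ B) {δ : ℝ} (hδ : 0 < δ)
    (hρ : 0 < μ.real {ω | δ ≤ Y 0 ω}) (hconv : ∀ᵐ ω ∂μ, Summable (fun n => a n * Y n ω)) :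
    Summable a := by
  have hB0 : 0 ≤ B := (ha 0).trans (hB 0)
  set S : Ω → ℝ := fun ω => ∑' n, a n * Y n ω with hS
  set SN : ℕ → Ω → ℝ := fun N ω => ∑ n ∈ Finset.range N, a n * Y n ω with hSN
  have hSNm : ∀ N, Measurable (SN N) := fun N =>
    Finset.measurable_sum _ fun n _ => (hY n).const_mul _
  have hSm : AEMeasurable S μ := by
    refine aemeasurable_of_tendsto_metrizable_ae atTop (fun N => (hSNm N).aemeasurable) ?_
    filter_upwards [hconv] with ω hω
    exact hω.hasSum.tendsto_sum_nat
  have hS0 : ∀ ω, 0 ≤ S ω := fun ω => tsum_nonneg fun n => mul_nonneg (ha n) (hY0 n ω)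
  have hSN0 : ∀ N ω, 0 ≤ SN N ω := fun N ω =>
    Finset.sum_nonneg fun n _ => mul_nonneg (ha n) (hY0 n ω)
  have hbdd : ∀ T : Ω → ℝ, AEMeasurable T μ → (∀ ω, 0 ≤ T ω) →
      Integrable (fun ω => Real.exp (-1 * T ω)) μ := by
    intro T hT hT0
    refine Integrable.of_bound (C := 1) (hT.const_mul (-1)).exp.aestronglyMeasurable
      (ae_of_all _ fun ω => ?_)
    rw [Real.norm_of_nonneg (Real.exp_pos _).le]
    exact Real.exp_le_one_iff.2 (by linarith [hT0 ω])
  -- The sum is real-valued, so its Laplace transform is positive; an infinite `∑ a n` would drive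
  -- those of the partial sums to `0`.
  have hε : 0 < mgf S μ (-1) := mgf_pos (hbdd S hSm hS0)
  set κ := μ.real {ω | δ ≤ Y 0 ω} * (δ / (1 + B * δ)) with hκ
  have hκ0 : 0 < κ := by positivity
  have hle : ∀ N, mgf S μ (-1) ≤ Real.exp (-(κ * ∑ n ∈ Finset.range N, a n)) := by
    intro N
    calc mgf S μ (-1) ≤ mgf (SN N) μ (-1) := by
          refine integral_mono_ae (hbdd S hSm hS0)
            (hbdd _ (hSNm N).aemeasurable (hSN0 N)) ?_
          filter_upwards [hconv] with ω hω
          have := hω.sum_le_tsum (Finset.range N) fun n _ => mul_nonneg (ha n) (hY0 n ω)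
          exact Real.exp_le_exp.2 (by linarith)
      _ = ∏ n ∈ Finset.range N, mgf (Y 0) μ (-a n) := by
          rw [hSN, mgf_weighted_sum_of_iid μ hY hind hid]
          simp
      _ ≤ ∏ n ∈ Finset.range N, Real.exp (-(κ * a n)) := by
          refine Finset.prod_le_prod (fun n _ => mgf_nonneg) fun n _ => ?_
          refine (mgf_neg_le_of_measureReal μ (hY 0) (hY0 0) δ (a n) hδ.le (ha n)).trans ?_
          refine Real.exp_le_exp.2 (neg_le_neg ?_)
          rw [hκ, mul_assoc]
          refine mul_le_mul_of_nonneg_left ?_ hρ.le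
          rw [div_mul_eq_mul_div, mul_comm δ]
          have := ha n
          gcongr
          exact hB n
      _ = _ := by rw [← Real.exp_sum, Finset.mul_sum, Finset.sum_neg_distrib]
  refine summable_of_sum_range_le (c := -Real.log (mgf S μ (-1)) / κ) ha fun N => ?_
  rw [le_div_iff₀ hκ0]
  have := (Real.log_le_iff_le_exp hε).2 (hle N)
  linarith

/-! ### Upper tail bounds -/

/-- Chernoff's bound for an almost surely convergent series of weighted i.i.d. variables. -/
theorem measureReal_tsum_ge_le_exp {Ω : Type*} [MeasurableSpace Ω] (μ : Measure Ω)
    [IsProbabilityMeasure μ] {Y : ℕ → Ω → ℝ} (hY : ∀ n, Measurable (Y n))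
    (hY0 : ∀ n ω, 0 ≤ Y n ω) (hind : iIndepFun Y μ) (hid : ∀ n, IdentDistrib (Y n) (Y 0) μ μ)
    {a : ℕ → ℝ} (ha : ∀ n, 0 ≤ a n) (hconv : ∀ᵐ ω ∂μ, Summable (fun n => a n * Y n ω))
    {t : ℝ} (ht : 0 ≤ t) {d : ℕ → ℝ} (hd0 : ∀ n, 0 ≤ d n) (hd : Summable d)
    (hint : ∀ n, Integrable (fun ω => Real.exp (t * a n * Y 0 ω)) μ)
    (hmgf : ∀ n, mgf (Y 0) μ (t * a n) ≤ Real.exp (d n)) (r : ℝ) :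
    μ.real {ω | r ≤ ∑' n, a n * Y n ω} ≤ Real.exp (-t * r + ∑' n, d n) := by
  set SN : ℕ → Ω → ℝ := fun N ω => ∑ n ∈ Finset.range N, a n * Y n ω with hSN
  have hN : ∀ (N : ℕ) (x : ℝ), μ.real {ω | x ≤ SN N ω} ≤ Real.exp (-t * x + ∑' n, d n) := by
    intro N x
    have hi : Integrable (fun ω => Real.exp (t * SN N ω)) μ := by
      have h1 : iIndepFun (fun n ω => a n * Y n ω) μ :=
        hind.comp (fun n x => a n * x) fun n => measurable_id.const_mul _
      have h2 := h1.integrable_exp_mul_sum (t := t) (s := Finset.range N)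
        (fun n => (hY n).const_mul _) (fun n _ => by
          have h3 := (hid n).comp (u := fun y => Real.exp (t * a n * y)) (by fun_prop)
          have h4 := h3.integrable_iff.2 (hint n)
          simpa only [Function.comp_def, mul_assoc] using h4)
      simpa using h2
    refine (measure_ge_le_exp_mul_mgf x ht hi).trans ?_
    rw [hSN, mgf_weighted_sum_of_iid μ hY hind hid, Real.exp_add]
    refine mul_le_mul_of_nonneg_left ?_ (Real.exp_pos _).le
    calc _ ≤ ∏ n ∈ Finset.range N, Real.exp (d n) :=
          Finset.prod_le_prod (fun n _ => mgf_nonneg) fun n _ => hmgf n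
      _ = Real.exp (∑ n ∈ Finset.range N, d n) := (Real.exp_sum _ _).symm
      _ ≤ _ := Real.exp_le_exp.2 (hd.sum_le_tsum _ fun n _ => hd0 n)
  -- Partial sums need not reach `r` when the series equals `r`, but they pass every `x < r`; the
  -- bound is continuous in `x`.
  have hlt : ∀ x < r, μ.real {ω | r ≤ ∑' n, a n * Y n ω} ≤ Real.exp (-t * x + ∑' n, d n) := by
    intro x hx
    have hmono : Monotone (fun N => {ω | x ≤ SN N ω}) := by
      intro M N hMN ω hω
      refine le_trans (show x ≤ SN M ω from hω) ?_
      exact Finset.sum_le_sum_of_subset_of_nonneg (Finset.range_mono hMN)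
        fun n _ _ => mul_nonneg (ha n) (hY0 n ω)
    have hU : μ.real (⋃ N, {ω | x ≤ SN N ω}) ≤ Real.exp (-t * x + ∑' n, d n) := by
      have h1 := tendsto_measure_iUnion_atTop (μ := μ) hmono
      have h2 := (ENNReal.tendsto_toReal (measure_ne_top μ _)).comp h1
      exact le_of_tendsto' h2 fun N => hN N x
    refine le_trans (ENNReal.toReal_mono (measure_ne_top _ _) (measure_mono_ae ?_)) hU
    filter_upwards [hconv] with ω hω hr
    have h1 : ∀ᶠ N in atTop, x < SN N ω :=
      hω.hasSum.tendsto_sum_nat.eventually (lt_mem_nhds (lt_of_lt_of_le hx hr))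
    obtain ⟨N, hN⟩ := h1.exists
    exact Set.mem_iUnion.2 ⟨N, hN.le⟩
  have hc : Tendsto (fun x : ℝ => Real.exp (-t * x + ∑' n, d n)) (𝓝[<] r)
      (𝓝 (Real.exp (-t * r + ∑' n, d n))) := by
    refine Tendsto.mono_left (Continuous.tendsto (by fun_prop) r) nhdsWithin_le_nhds
  exact ge_of_tendsto hc (eventually_nhdsWithin_of_forall hlt)

/-- Near `0` a moment generating function is at most exponential of a linear function. -/
theorem mgf_le_exp_mul_of_le_one {Ω : Type*} [MeasurableSpace Ω] (μ : Measure Ω)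
    [IsProbabilityMeasure μ] {W : Ω → ℝ} (hW : Integrable (fun ω => Real.exp (W ω)) μ) {t : ℝ}
    (ht0 : 0 ≤ t) (ht1 : t ≤ 1) :
    mgf W μ t ≤ Real.exp (t * (∫ ω, Real.exp (W ω) ∂μ - 1)) := by
  calc mgf W μ t ≤ ∫ ω, ((1 - t) + t * Real.exp (W ω)) ∂μ := by
        refine integral_mono_of_nonneg (ae_of_all _ fun ω => (Real.exp_pos _).le)
          ((integrable_const _).add (hW.const_mul t)) (ae_of_all _ fun ω => ?_)
        -- Convexity of `exp` along the chord from `0` to `W ω`.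
        have h := convexOn_exp.2 (Set.mem_univ 0) (Set.mem_univ (W ω)) (sub_nonneg.2 ht1) ht0
          (by ring)
        simpa using h
    _ = t * (∫ ω, Real.exp (W ω) ∂μ - 1) + 1 := by
        rw [integral_add (integrable_const _) (hW.const_mul t), integral_const_mul]
        simp
        ring
    _ ≤ _ := Real.add_one_le_exp _

/-- If `exp (α ^ s / s * Y ^ s)` is integrable, then the cumulant generating function of `Y` is at
most the Legendre transform of `x ↦ α ^ s / s * x ^ s`, up to a linear function. -/
theorem exists_mgf_le_exp_rpow_add_mul {Ω : Type*} [MeasurableSpace Ω] (μ : Measure Ω)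
    [IsProbabilityMeasure μ] {Y : Ω → ℝ} (hY : Measurable Y) (hY0 : ∀ ω, 0 ≤ Y ω) {s q α : ℝ}
    (hsq : s.HolderConjugate q) (hα : 0 < α)
    (hM : Integrable (fun ω => Real.exp (α ^ s / s * Y ω ^ s)) μ) :
    ∃ K, 0 ≤ K ∧ ∀ t, 0 ≤ t → Integrable (fun ω => Real.exp (t * Y ω)) μ ∧
      mgf Y μ t ≤ Real.exp ((t / α) ^ q / q + K * t) := by
  have hs := hsq.pos
  have hq := hsq.symm.pos
  set M := ∫ ω, Real.exp (α ^ s / s * Y ω ^ s) ∂μ with hMdef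
  have hyoung : ∀ t, 0 ≤ t → ∀ ω, Real.exp (t * Y ω) ≤
      Real.exp ((t / α) ^ q / q) * Real.exp (α ^ s / s * Y ω ^ s) := by
    intro t ht ω
    rw [← Real.exp_add]
    refine Real.exp_le_exp.2 ?_
    have h := Real.young_inequality_of_nonneg (mul_nonneg hα.le (hY0 ω)) (div_nonneg ht hα.le) hsq
    rw [Real.mul_rpow hα.le (hY0 ω)] at h
    calc t * Y ω = α * Y ω * (t / α) := by field_simp
      _ ≤ _ := h
      _ = _ := by ring
  have hint : ∀ t, 0 ≤ t → Integrable (fun ω => Real.exp (t * Y ω)) μ := fun t ht =>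
    (hM.const_mul (Real.exp ((t / α) ^ q / q))).mono' (hY.const_mul t).exp.aestronglyMeasurable
      (ae_of_all _ fun ω => by
        rw [Real.norm_of_nonneg (Real.exp_pos _).le]
        exact hyoung t ht ω)
  have hbound : ∀ t, 0 ≤ t → mgf Y μ t ≤ Real.exp ((t / α) ^ q / q) * M := by
    intro t ht
    rw [hMdef, ← integral_const_mul]
    exact integral_mono (hint t ht) (hM.const_mul _) (hyoung t ht)
  have hM0 : 0 < M := integral_exp_pos hM
  -- The error must vanish at `t = 0` to be summable over infinitely many coefficients. For `t ≤ 1`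
  -- the chord bound is linear in `t`; for `t ≥ 1` the constant `log M` is absorbed into `K * t`.
  refine ⟨max 0 (max (Real.log M) (∫ ω, Real.exp (Y ω) ∂μ - 1)), le_max_left _ _,
    fun t ht => ⟨hint t ht, ?_⟩⟩
  set K := max 0 (max (Real.log M) (∫ ω, Real.exp (Y ω) ∂μ - 1))
  have hK0 : 0 ≤ K := le_max_left _ _
  have hK1 : Real.log M ≤ K := (le_max_left _ _).trans (le_max_right _ _)
  have hK2 : ∫ ω, Real.exp (Y ω) ∂μ - 1 ≤ K := (le_max_right _ _).trans (le_max_right _ _)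
  rcases le_total t 1 with h1 | h1
  · refine (mgf_le_exp_mul_of_le_one μ (by simpa using hint 1 zero_le_one) ht h1).trans ?_
    refine Real.exp_le_exp.2 ?_
    have : 0 ≤ (t / α) ^ q / q := by positivity
    nlinarith
  · refine (hbound t ht).trans ?_
    rw [Real.exp_add]
    refine mul_le_mul_of_nonneg_left ?_ (Real.exp_pos _).le
    rw [← Real.log_le_iff_le_exp hM0]
    nlinarith

/-- The upper tail bound for the series when the tail exponent is `s = 1`. -/
theorem exists_measureReal_tsum_ge_le_one {Ω : Type*} [MeasurableSpace Ω] (μ : Measure Ω)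
    [IsProbabilityMeasure μ] {Y : ℕ → Ω → ℝ} (hY : ∀ n, Measurable (Y n))
    (hY0 : ∀ n ω, 0 ≤ Y n ω) (hind : iIndepFun Y μ) (hid : ∀ n, IdentDistrib (Y n) (Y 0) μ μ)
    {a : ℕ → ℝ} (ha : ∀ n, 0 ≤ a n) (hasum : Summable a)
    (hconv : ∀ᵐ ω ∂μ, Summable (fun n => a n * Y n ω)) {A θ : ℝ} (hA0 : 0 < A)
    (hA : ∀ n, a n ≤ A) (hθ : 0 ≤ θ) (hM : Integrable (fun ω => Real.exp (θ * Y 0 ω)) μ) :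
    ∃ B, ∀ r, μ.real {ω | r ≤ ∑' n, a n * Y n ω} ≤ Real.exp (-(θ / A) * r + B) := by
  set M := ∫ ω, Real.exp (θ * Y 0 ω) ∂μ with hMdef
  have hM1 : 1 ≤ M := by
    have h := integral_mono (μ := μ) (integrable_const (1 : ℝ)) hM fun ω =>
      Real.one_le_exp (mul_nonneg hθ (hY0 0 ω))
    simpa using h
  have hr : ∀ n, 0 ≤ a n / A := fun n => div_nonneg (ha n) hA0.le
  have hr1 : ∀ n, a n / A ≤ 1 := fun n => (div_le_one hA0).2 (hA n)
  have heq : ∀ n, θ / A * a n = θ * (a n / A) := fun n => by ring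
  -- The Chernoff parameter `θ / A` keeps every `t * a n` at most `θ`.
  refine ⟨∑' n, a n / A * (M - 1), fun r => ?_⟩
  refine measureReal_tsum_ge_le_exp μ hY hY0 hind hid ha hconv (div_nonneg hθ hA0.le)
    (fun n => mul_nonneg (hr n) (by linarith)) ((hasum.div_const A).mul_right _) ?_ ?_ r
  · intro n
    refine hM.mono' ((hY 0).const_mul _).exp.aestronglyMeasurable (ae_of_all _ fun ω => ?_)
    rw [Real.norm_of_nonneg (Real.exp_pos _).le, heq]
    refine Real.exp_le_exp.2 (mul_le_mul_of_nonneg_right ?_ (hY0 0 ω))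
    exact mul_le_of_le_one_right hθ (hr1 n)
  · intro n
    rw [heq, ← mgf_const_mul]
    exact mgf_le_exp_mul_of_le_one μ hM (hr n) (hr1 n)

/-- The upper tail bound for the series when the tail exponent is `s > 1`. -/
theorem exists_measureReal_tsum_ge_le_rpow {Ω : Type*} [MeasurableSpace Ω] (μ : Measure Ω)
    [IsProbabilityMeasure μ] {Y : ℕ → Ω → ℝ} (hY : ∀ n, Measurable (Y n))
    (hY0 : ∀ n ω, 0 ≤ Y n ω) (hind : iIndepFun Y μ) (hid : ∀ n, IdentDistrib (Y n) (Y 0) μ μ)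
    {a : ℕ → ℝ} (ha : ∀ n, 0 ≤ a n) (hasum : Summable a)
    (hconv : ∀ᵐ ω ∂μ, Summable (fun n => a n * Y n ω)) {s q θ : ℝ} (hsq : s.HolderConjugate q)
    (haq : Summable (fun n => a n ^ q)) (hA0 : 0 < ∑' n, a n ^ q) (hθ : 0 < θ)
    (hM : Integrable (fun ω => Real.exp (θ * Y 0 ω ^ s)) μ) :
    ∃ B, ∀ r, 0 < r → μ.real {ω | r ≤ ∑' n, a n * Y n ω} ≤
      Real.exp (-(θ / (∑' n, a n ^ q) ^ (s - 1)) * r ^ s + B * r ^ (s - 1)) := by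
  have hs := hsq.pos
  have hq := hsq.symm.pos
  set A := ∑' n, a n ^ q with hA
  -- Chosen so that `α ^ s / s = θ`.
  set α := (s * θ) ^ s⁻¹ with hαdef
  have hα : 0 < α := by positivity
  have hαs : α ^ s = s * θ := Real.rpow_inv_rpow (by positivity) hs.ne'
  obtain ⟨K, hK0, hK⟩ := exists_mgf_le_exp_rpow_add_mul μ (hY 0) (hY0 0) hsq hα (by
    rw [hαs, mul_div_cancel_left₀ _ hs.ne']
    exact hM)
  -- With this `l`, `t = l * r ^ (s - 1)` minimizes `-t * r + (t / α) ^ q / q * A`.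
  set l := α ^ s / A ^ (s - 1) with hl
  have hl0 : 0 < l := by positivity
  refine ⟨K * l * ∑' n, a n, fun r hr => ?_⟩
  set t := l * r ^ (s - 1) with ht
  have ht0 : 0 < t := by positivity
  have hd : ∀ n, (t * a n / α) ^ q / q + K * (t * a n) =
      (t / α) ^ q / q * a n ^ q + K * t * a n := by
    intro n
    rw [mul_div_right_comm, Real.mul_rpow (by positivity) (ha n)]
    ring
  have hsum : HasSum (fun n => (t * a n / α) ^ q / q + K * (t * a n))
      ((t / α) ^ q / q * A + K * t * ∑' n, a n) := by
    simp only [hd]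
    exact (haq.hasSum.mul_left _).add (hasum.hasSum.mul_left _)
  have hta : ∀ n, 0 ≤ t * a n := fun n => mul_nonneg ht0.le (ha n)
  have key := measureReal_tsum_ge_le_exp μ hY hY0 hind hid ha hconv ht0.le
    (fun n => by have := hta n; positivity) hsum.summable (fun n => (hK _ (hta n)).1)
    (fun n => (hK _ (hta n)).2) r
  refine key.trans (le_of_eq ?_)
  rw [hsum.tsum_eq]
  congr 1
  have htr : t * r = l * r ^ s := by
    rw [ht, mul_assoc, ← Real.rpow_add_one hr.ne']
    simp
  have hpow : (t / α) ^ q * A = l * r ^ s := by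
    have e1 : (t / α) ^ q = l ^ q * r ^ s / α ^ q := by
      rw [ht, Real.div_rpow (by positivity) hα.le, Real.mul_rpow hl0.le (by positivity),
        ← Real.rpow_mul hr.le, hsq.sub_one_mul_conj]
    have e2 : l ^ q = α ^ s * α ^ q / A ^ s := by
      rw [hl, Real.div_rpow (by positivity) (by positivity), ← Real.rpow_mul hα.le,
        ← Real.rpow_mul hA0.le, hsq.sub_one_mul_conj, hsq.mul_eq_add, Real.rpow_add hα]
    have e3 : A ^ s = A ^ (s - 1) * A := by
      rw [← Real.rpow_add_one hA0.ne']
      simp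
    rw [e1, e2, e3, hl]
    have : α ^ q ≠ 0 := by positivity
    have : A ^ (s - 1) ≠ 0 := by positivity
    field_simp
  have hlθ : θ / A ^ (s - 1) = l / s := by
    rw [hl, hαs]
    field_simp
  have hqs : q⁻¹ = 1 - s⁻¹ := by linarith [hsq.inv_add_inv_eq_one]
  calc -t * r + ((t / α) ^ q / q * A + K * t * ∑' n, a n)
      = -(t * r) + (t / α) ^ q * A * q⁻¹ + K * t * ∑' n, a n := by ring
    _ = _ := by
        rw [htr, hpow, hlθ, hqs, ht]
        ring

/-! ### Consequences of the logarithmic tail -/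

/-- A variable with a logarithmic tail limit `-c < 0` takes large values with positive
probability. -/
theorem eventually_measureReal_pos_of_log_tail {Ω : Type*} [MeasurableSpace Ω] (μ : Measure Ω)
    {Y : Ω → ℝ} {s c : ℝ} (hc : 0 < c)
    (htail : Tendsto (fun u : ℝ => u ^ (-s) * Real.log (μ.real {ω | u ≤ Y ω})) atTop (𝓝 (-c))) :
    ∀ᶠ u : ℝ in atTop, 0 < μ.real {ω | u ≤ Y ω} := by
  -- As `Real.log 0 = 0`, a zero probability would give the value `0`, away from the limit `-c`.
  filter_upwards [htail.eventually_ne (neg_ne_zero.2 hc.ne')] with u hu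
  refine measureReal_nonneg.lt_of_ne fun h => hu ?_
  rw [← h]
  simp

/-- The logarithmic tail limit yields exponential moments of `Y ^ s` of every order `θ < c`. -/
theorem integrable_exp_mul_rpow_of_log_tail {Ω : Type*} [MeasurableSpace Ω] (μ : Measure Ω)
    [IsProbabilityMeasure μ] {Y : Ω → ℝ} (hY : Measurable Y) (hY0 : ∀ ω, 0 ≤ Y ω) {s c θ : ℝ}
    (hs : 0 < s) (hc : 0 < c)
    (htail : Tendsto (fun u : ℝ => u ^ (-s) * Real.log (μ.real {ω | u ≤ Y ω})) atTop (𝓝 (-c)))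
    (hθ : 0 ≤ θ) (hθc : θ < c) :
    Integrable (fun ω => Real.exp (θ * Y ω ^ s)) μ := by
  obtain ⟨θ', h1, h2⟩ := exists_between hθc
  refine integrable_exp_mul_of_tail_le μ (hY.pow_const s)
    (fun ω => Real.rpow_nonneg (hY0 ω) s) hθ h1 ?_
  have hev : ∀ᶠ u : ℝ in atTop, μ.real {ω | u ≤ Y ω} ≤ Real.exp (-θ' * u ^ s) := by
    filter_upwards [eventually_measureReal_pos_of_log_tail μ hc htail, eventually_gt_atTop 0,
      htail.eventually (gt_mem_nhds (neg_lt_neg h2))] with u hpos hu hlt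
    rw [← Real.log_le_iff_le_exp hpos]
    rw [Real.rpow_neg hu.le, inv_mul_lt_iff₀ (by positivity)] at hlt
    linarith
  filter_upwards [(tendsto_rpow_atTop (inv_pos.2 hs)).eventually hev, eventually_ge_atTop 0]
    with v hv hv0
  rw [Real.rpow_inv_rpow hv0 hs.ne'] at hv
  convert hv using 4 with ω
  exact (Real.rpow_inv_le_iff_of_pos hv0 (hY0 ω) hs).symm

/-! ### Lower tail bounds -/

/-- The lower tail bound for the series obtained from forcing finitely many terms to be large. -/
theorem eventually_lt_log_measureReal_tsum_ge {Ω : Type*} [MeasurableSpace Ω] (μ : Measure Ω)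
    [IsProbabilityMeasure μ] {Y : ℕ → Ω → ℝ}
    (hY0 : ∀ n ω, 0 ≤ Y n ω) (hind : iIndepFun Y μ) (hid : ∀ n, IdentDistrib (Y n) (Y 0) μ μ)
    {a : ℕ → ℝ} (ha : ∀ n, 0 ≤ a n) (hconv : ∀ᵐ ω ∂μ, Summable (fun n => a n * Y n ω))
    {s c : ℝ} (hc : 0 < c)
    (htail : Tendsto (fun u : ℝ => u ^ (-s) * Real.log (μ.real {ω | u ≤ Y 0 ω})) atTop (𝓝 (-c)))
    (F : Finset ℕ) (w : ℕ → ℝ) (hw : ∀ n ∈ F, 0 < w n) (hsum : 1 ≤ ∑ n ∈ F, a n * w n) {y : ℝ}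
    (hy : c * ∑ n ∈ F, w n ^ s < y) :
    ∀ᶠ r : ℝ in atTop, 0 < μ.real {ω | r ≤ ∑' n, a n * Y n ω} ∧
      -y < r ^ (-s) * Real.log (μ.real {ω | r ≤ ∑' n, a n * Y n ω}) := by
  have hle : ∀ r : ℝ, 0 ≤ r → ∏ n ∈ F, μ.real {ω | r * w n ≤ Y 0 ω} ≤
      μ.real {ω | r ≤ ∑' n, a n * Y n ω} := by
    intro r hr
    have h1 := hind.measure_inter_preimage_eq_mul F (sets := fun n => Set.Ici (r * w n))
      fun n _ => measurableSet_Ici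
    have h2 : ∏ n ∈ F, μ.real {ω | r * w n ≤ Y 0 ω} =
        μ.real (⋂ n ∈ F, Y n ⁻¹' Set.Ici (r * w n)) := by
      rw [measureReal_def, h1, ENNReal.toReal_prod]
      refine Finset.prod_congr rfl fun n _ => ?_
      rw [(hid n).measure_mem_eq measurableSet_Ici]
      rfl
    rw [h2]
    refine ENNReal.toReal_mono (measure_ne_top _ _) (measure_mono_ae ?_)
    filter_upwards [hconv] with ω hω hmem
    have hmem' : ∀ n ∈ F, r * w n ≤ Y n ω := by
      have : ω ∈ ⋂ n ∈ F, Y n ⁻¹' Set.Ici (r * w n) := hmem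
      simpa using this
    calc r ≤ r * ∑ n ∈ F, a n * w n := le_mul_of_one_le_right hr hsum
      _ = ∑ n ∈ F, a n * (r * w n) := by
        rw [Finset.mul_sum]
        exact Finset.sum_congr rfl fun n _ => by ring
      _ ≤ ∑ n ∈ F, a n * Y n ω :=
        Finset.sum_le_sum fun n hn => mul_le_mul_of_nonneg_left (hmem' n hn) (ha n)
      _ ≤ _ := hω.sum_le_tsum F fun n _ => mul_nonneg (ha n) (hY0 n ω)
  have hscale : ∀ n ∈ F, Tendsto (fun r : ℝ => r * w n) atTop atTop := fun n hn =>
    tendsto_id.atTop_mul_const (hw n hn)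
  have hpos : ∀ᶠ r : ℝ in atTop, ∀ n ∈ F, 0 < μ.real {ω | r * w n ≤ Y 0 ω} :=
    (Finset.eventually_all F).2 fun n hn =>
      (hscale n hn).eventually (eventually_measureReal_pos_of_log_tail μ hc htail)
  have hlim : Tendsto (fun r : ℝ => ∑ n ∈ F,
      w n ^ s * ((r * w n) ^ (-s) * Real.log (μ.real {ω | r * w n ≤ Y 0 ω}))) atTop
      (𝓝 (∑ n ∈ F, w n ^ s * -c)) :=
    tendsto_finsetSum F fun n hn => (htail.comp (hscale n hn)).const_mul _
  have hlt : -y < ∑ n ∈ F, w n ^ s * -c := by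
    rw [← Finset.sum_mul]
    linarith
  filter_upwards [hpos, hlim.eventually (lt_mem_nhds hlt), eventually_gt_atTop 0] with r h1 h2 hr
  refine ⟨(Finset.prod_pos h1).trans_le (hle r hr.le), h2.trans_le ?_⟩
  have h3 : ∑ n ∈ F, w n ^ s * ((r * w n) ^ (-s) * Real.log (μ.real {ω | r * w n ≤ Y 0 ω})) =
      r ^ (-s) * Real.log (∏ n ∈ F, μ.real {ω | r * w n ≤ Y 0 ω}) := by
    rw [Real.log_prod fun n hn => (h1 n hn).ne', Finset.mul_sum]
    refine Finset.sum_congr rfl fun n hn => ?_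
    have hwn := hw n hn
    rw [Real.mul_rpow hr.le hwn.le, Real.rpow_neg hwn.le]
    have : w n ^ s ≠ 0 := by positivity
    field_simp
  rw [h3]
  refine mul_le_mul_of_nonneg_left ?_ (by positivity)
  exact Real.log_le_log (Finset.prod_pos h1) (hle r hr.le)

/-- Nearly extremal weights in Hölder's inequality for `s > 1`. -/
theorem exists_weights_sum_rpow_lt {a : ℕ → ℝ} (ha : ∀ n, 0 < a n) {s q : ℝ}
    (hsq : s.HolderConjugate q) (haq : Summable (fun n => a n ^ q)) {y : ℝ}
    (hy : 1 / (∑' n, a n ^ q) ^ (s - 1) < y) :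
    ∃ (F : Finset ℕ) (w : ℕ → ℝ), (∀ n ∈ F, 0 < w n) ∧ 1 ≤ ∑ n ∈ F, a n * w n ∧
      ∑ n ∈ F, w n ^ s < y := by
  have hA0 : 0 < ∑' n, a n ^ q :=
    haq.tsum_pos (fun n => (Real.rpow_pos_of_pos (ha n) q).le) 0 (Real.rpow_pos_of_pos (ha 0) q)
  have hlim : Tendsto (fun N => 1 / (∑ n ∈ Finset.range N, a n ^ q) ^ (s - 1)) atTop
      (𝓝 (1 / (∑' n, a n ^ q) ^ (s - 1))) :=
    tendsto_const_nhds.div (haq.hasSum.tendsto_sum_nat.rpow_const (Or.inl hA0.ne'))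
      (by positivity)
  obtain ⟨N, hN1, hN⟩ := ((eventually_gt_atTop 0).and
    (hlim.eventually (gt_mem_nhds hy))).exists
  set A := ∑ n ∈ Finset.range N, a n ^ q with hA
  have hAN : 0 < A := Finset.sum_pos (fun n _ => Real.rpow_pos_of_pos (ha n) q)
    (Finset.nonempty_range_iff.2 hN1.ne')
  -- The equality case of Hölder for the truncated sequence; `(q - 1) * s = q` gives `∑ w n ^ s = A
  -- ^ (1 - s)`.
  refine ⟨Finset.range N, fun n => a n ^ (q - 1) / A, fun n _ => ?_, ?_, ?_⟩
  · have := ha n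
    positivity
  · refine le_of_eq ?_
    have : ∀ n, a n * (a n ^ (q - 1) / A) = a n ^ q / A := fun n => by
      rw [← mul_div_assoc, mul_comm, ← Real.rpow_add_one (ha n).ne', sub_add_cancel]
    simp only [this]
    rw [← Finset.sum_div, div_self hAN.ne']
  · refine lt_of_eq_of_lt ?_ hN
    have : ∀ n, (a n ^ (q - 1) / A) ^ s = a n ^ q / A ^ s := fun n => by
      have := ha n
      rw [Real.div_rpow (by positivity) hAN.le, ← Real.rpow_mul this.le,
        hsq.symm.sub_one_mul_conj]
    simp only [this]
    rw [← Finset.sum_div, ← hA, Real.rpow_sub_one hAN.ne']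
    field_simp

/-! ### Tail asymptotics of the series -/

/-- Logarithmic tail asymptotics from an upper tail bound `exp (-(θ L) r ^ s + B r ^ (s - 1))` for
every `θ < c` together with matching lower bounds. -/
theorem tendsto_log_tail_of_bounds {f : ℝ → ℝ} {s c L : ℝ} (hc : 0 < c) (hL : 0 < L)
    (hupper : ∀ θ, 0 < θ → θ < c → ∃ B, ∀ r, 0 < r →
      f r ≤ Real.exp (-(θ * L) * r ^ s + B * r ^ (s - 1)))
    (hlower : ∀ y, c * L < y → ∀ᶠ r : ℝ in atTop, 0 < f r ∧ -y < r ^ (-s) * Real.log (f r)) :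
    Tendsto (fun r : ℝ => r ^ (-s) * Real.log (f r)) atTop (𝓝 (-(c * L))) := by
  refine tendsto_order.2 ⟨fun y hy => ?_, fun y hy => ?_⟩
  · filter_upwards [hlower (-y) (by linarith)] with r hr
    linarith [hr.2]
  · obtain ⟨θ, h1, h2⟩ := exists_between (show max 0 (-y / L) < c from
      -- `θ > -y / L` makes the limiting upper bound `-(θ * L)` smaller than `y`.
      max_lt hc (by rw [div_lt_iff₀ hL]; linarith))
    obtain ⟨h0, h1⟩ := max_lt_iff.1 h1
    rw [div_lt_iff₀ hL] at h1
    obtain ⟨B, hB⟩ := hupper θ h0 h2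
    have hlim : Tendsto (fun r : ℝ => -(θ * L) + B * r⁻¹) atTop (𝓝 (-(θ * L) + B * 0)) :=
      tendsto_const_nhds.add (tendsto_inv_atTop_zero.const_mul B)
    filter_upwards [hlim.eventually (gt_mem_nhds (show -(θ * L) + B * 0 < y by linarith)),
      hlower (c * L + 1) (by linarith), eventually_gt_atTop 0] with r h3 h4 hr
    refine lt_of_le_of_lt ?_ h3
    rw [Real.rpow_neg hr.le, inv_mul_le_iff₀ (by positivity)]
    refine ((Real.log_le_iff_le_exp h4.1).2 (hB r hr)).trans (le_of_eq ?_)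
    rw [Real.rpow_sub_one hr.ne']
    ring

theorem lqNorm_top_eq {a : ℕ → ℝ} (ha : ∀ n, 0 < a n) : lqNorm ∞ a = ⨆ n, a n := by
  simp [lqNorm, abs_of_pos (ha _)]

theorem lqNorm_eq_rpow {q : ℝ≥0∞} (hq : q ≠ ∞) {a : ℕ → ℝ} (ha : ∀ n, 0 < a n) :
    lqNorm q a = (∑' n, a n ^ q.toReal) ^ (1 / q.toReal) := by
  simp [lqNorm, hq, abs_of_pos (ha _)]

/-- Finiteness of `q` is what excludes `s = 1`, which would force `1 / q = 0`. -/
theorem holderConjugate_toReal {s : ℝ} (hs : 1 ≤ s) {q : ℝ≥0∞} (hq : q ≠ ∞)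
    (h : 1 / ENNReal.ofReal s + 1 / q = 1) : s.HolderConjugate q.toReal := by
  have hs0 : 0 < s := by linarith
  rw [one_div, one_div] at h
  have hq0 : q ≠ 0 := by
    rintro rfl
    simp at h
  have hsr : (ENNReal.ofReal s)⁻¹ ≠ ∞ := by simpa using hs0
  have h1 := congrArg ENNReal.toReal h
  rw [ENNReal.toReal_add hsr (by simpa using hq0), ENNReal.toReal_inv, ENNReal.toReal_inv,
    ENNReal.toReal_ofReal hs0.le, ENNReal.toReal_one] at h1
  refine Real.holderConjugate_iff.2 ⟨?_, h1⟩
  have h2 : 0 < q.toReal⁻¹ := inv_pos.2 (ENNReal.toReal_pos hq0 hq)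
  by_contra hle
  have h3 : s = 1 := le_antisymm (not_lt.1 hle) hs
  rw [h3] at h1
  norm_num at h1
  simp [h1] at h2

/-- A positive sequence with a summable positive power is bounded. -/
theorem exists_forall_le_of_summable_rpow {a : ℕ → ℝ} (ha : ∀ n, 0 < a n) {m : ℝ} (hm : 0 < m)
    (h : Summable fun n => a n ^ m) : ∃ B, ∀ n, a n ≤ B := by
  obtain ⟨C, hC⟩ := h.tendsto_atTop_zero.bddAbove_range
  have hC' : ∀ n, a n ^ m ≤ C := fun n => hC ⟨n, rfl⟩
  have hC0 : 0 ≤ C := (Real.rpow_nonneg (ha 0).le m).trans (hC' 0)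
  exact ⟨C ^ m⁻¹, fun n => (Real.le_rpow_inv_iff_of_pos (ha n).le hC0 hm).2 (hC' n)⟩

/-- A summable positive sequence has summable powers of every order `q ≥ 1`. -/
theorem summable_rpow_of_summable {a : ℕ → ℝ} (ha : ∀ n, 0 < a n) (h : Summable a) {q : ℝ}
    (hq : 1 ≤ q) : Summable fun n => a n ^ q := by
  refine Summable.of_norm_bounded_eventually_nat h ?_
  filter_upwards [h.tendsto_atTop_zero.eventually (gt_mem_nhds one_pos)] with n hn
  rw [Real.norm_of_nonneg (Real.rpow_nonneg (ha n).le q)]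
  simpa using Real.rpow_le_rpow_of_exponent_ge (ha n) hn.le hq

/-- Logarithmic tail asymptotics of a series of weighted i.i.d. nonnegative variables. -/
theorem tendsto_log_measureReal_tsum_ge {Ω : Type*} [MeasurableSpace Ω] (μ : Measure Ω)
    [IsProbabilityMeasure μ] {Y : ℕ → Ω → ℝ} (hY : ∀ n, Measurable (Y n))
    (hY0 : ∀ n ω, 0 ≤ Y n ω) (hind : iIndepFun Y μ) (hid : ∀ n, IdentDistrib (Y n) (Y 0) μ μ)
    {s c : ℝ} (hs : 1 ≤ s) (hc : 0 < c)
    (htail : Tendsto (fun u : ℝ => u ^ (-s) * Real.log (μ.real {ω | u ≤ Y 0 ω})) atTop (𝓝 (-c)))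
    {q : ℝ≥0∞} (hq : 1 / ENNReal.ofReal s + 1 / q = 1) {a : ℕ → ℝ} (ha : ∀ n, 0 < a n)
    (hasum : Summable (fun n => a n ^ (min 2 q).toReal))
    (hconv : ∀ᵐ ω ∂μ, Summable (fun n => a n * Y n ω)) :
    0 < lqNorm q a ∧
    Tendsto (fun r : ℝ => r ^ (-s) * Real.log (μ.real {ω | r ≤ ∑' n, a n * Y n ω})) atTop
      (𝓝 (-(c * (1 / lqNorm q a ^ s)))) := by
  have hs0 : 0 < s := by linarith
  have ha0 : ∀ n, 0 ≤ a n := fun n => (ha n).le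
  have hq0 : q ≠ 0 := by
    rintro rfl
    simp at hq
  have hm : 0 < (min 2 q).toReal :=
    ENNReal.toReal_pos (lt_min two_pos hq0.bot_lt).ne' (by simp)
  obtain ⟨B, hB⟩ := exists_forall_le_of_summable_rpow ha hm hasum
  obtain ⟨δ, hρ, hδ⟩ := ((eventually_measureReal_pos_of_log_tail μ hc htail).and
    (eventually_gt_atTop 0)).exists
  have hsum := summable_coeff_of_ae_summable μ hY hY0 hind hid ha0 hB hδ hρ hconv
  have hM : ∀ θ, 0 < θ → θ < c → Integrable (fun ω => Real.exp (θ * Y 0 ω ^ s)) μ :=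
    fun θ h1 h2 => integrable_exp_mul_rpow_of_log_tail μ (hY 0) (hY0 0) hs0 hc htail h1.le h2
  by_cases hqt : q = ∞
  · subst hqt
    have hs1 : s = 1 := by simpa using hq
    subst hs1
    have hbdd : BddAbove (Set.range a) := ⟨B, by rintro _ ⟨n, rfl⟩; exact hB n⟩
    rw [lqNorm_top_eq ha, Real.rpow_one]
    set A := ⨆ n, a n
    have hA : ∀ n, a n ≤ A := le_ciSup hbdd
    have hA0 : 0 < A := (ha 0).trans_le (hA 0)
    refine ⟨hA0, tendsto_log_tail_of_bounds hc (by positivity) (fun θ h1 h2 => ?_)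
      fun y hy => ?_⟩
    · obtain ⟨C, hC⟩ := exists_measureReal_tsum_ge_le_one μ hY hY0 hind hid ha0 hsum hconv hA0 hA
        h1.le (by simpa using hM θ h1 h2)
      refine ⟨C, fun r _ => ?_⟩
      simpa [div_eq_mul_inv] using hC r
    · have hy0 : 0 < y := lt_trans (by positivity) hy
      have hlt : c / y < A := by
        rw [div_lt_iff₀ hy0]
        rw [mul_one_div, div_lt_iff₀ hA0] at hy
        linarith
      -- The supremum need not be attained: one term with `a n` close enough to it carries the whole
      -- deviation.
      obtain ⟨n, hn⟩ := exists_lt_of_lt_ciSup hlt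
      have hn0 := ha n
      refine eventually_lt_log_measureReal_tsum_ge μ hY0 hind hid ha0 hconv hc htail {n}
        (fun n => (a n)⁻¹) (fun n _ => inv_pos.2 (ha n)) ?_ ?_
      · simp [hn0.ne']
      · rw [div_lt_iff₀ hy0] at hn
        rw [Finset.sum_singleton, Real.rpow_one, ← div_eq_mul_inv, div_lt_iff₀ hn0]
        linarith
  · have hsq := holderConjugate_toReal hs hqt hq
    have haq := summable_rpow_of_summable ha hsum hsq.symm.lt.le
    have hA0 : 0 < ∑' n, a n ^ q.toReal :=
      haq.tsum_pos (fun n => (Real.rpow_pos_of_pos (ha n) _).le) 0 (Real.rpow_pos_of_pos (ha 0) _)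
    -- The exponents agree because `s / q = s - 1` for conjugate `s` and `q`.
    have hnorm : lqNorm q a ^ s = (∑' n, a n ^ q.toReal) ^ (s - 1) := by
      rw [lqNorm_eq_rpow hqt ha, ← Real.rpow_mul hA0.le]
      congr 1
      have := hsq.symm.pos
      have := hsq.sub_one_mul_conj
      field_simp
      linarith
    refine ⟨by rw [lqNorm_eq_rpow hqt ha]; positivity, ?_⟩
    rw [hnorm]
    refine tendsto_log_tail_of_bounds hc (by positivity) (fun θ h1 h2 => ?_) fun y hy => ?_
    · obtain ⟨C, hC⟩ := exists_measureReal_tsum_ge_le_rpow μ hY hY0 hind hid ha0 hsum hconv hsq haq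
        hA0 h1 (hM θ h1 h2)
      refine ⟨C, fun r hr => ?_⟩
      simpa [div_eq_mul_inv] using hC r hr
    · rw [← lt_div_iff₀' hc] at hy
      obtain ⟨F, w, hw, h1, h2⟩ := exists_weights_sum_rpow_lt ha hsq haq hy
      rw [lt_div_iff₀' hc] at h2
      exact eventually_lt_log_measureReal_tsum_ge μ hY0 hind hid ha0 hconv hc htail F w hw h1 h2

/-! ### Transfer to `|ξ|` and the ratio limits -/

/-- The tail limit of `|X|` at rate `u ^ p` gives that of `|X| ^ k` at rate `u ^ (p / k)`. -/
theorem tendsto_log_tail_abs_rpow {Ω : Type*} [MeasurableSpace Ω] (μ : Measure Ω) {X : Ω → ℝ}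
    {k p c : ℝ} (hk : 0 < k)
    (htail : Tendsto (fun u : ℝ => u ^ (-p) * Real.log (μ.real {ω | u ≤ |X ω|}))
      atTop (𝓝 (-c))) :
    Tendsto (fun u : ℝ => u ^ (-(p / k)) * Real.log (μ.real {ω | u ≤ |X ω| ^ k}))
      atTop (𝓝 (-c)) := by
  refine (htail.comp (tendsto_rpow_atTop (inv_pos.2 hk))).congr' ?_
  filter_upwards [eventually_ge_atTop 0] with u hu
  have h1 : {ω | u ^ k⁻¹ ≤ |X ω|} = {ω | u ≤ |X ω| ^ k} := by
    ext ω
    exact Real.rpow_inv_le_iff_of_pos hu (abs_nonneg _) hk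
  have h2 : (u ^ k⁻¹) ^ (-p) = u ^ (-(p / k)) := by
    rw [← Real.rpow_mul hu]
    congr 1
    ring
  simp only [Function.comp_apply, h1, h2]

theorem proposition3p4 {Ω : Type*} [MeasurableSpace Ω] (μ : Measure Ω) [IsProbabilityMeasure μ]
    (ξ : ℕ → Ω → ℝ) (hmeas : ∀ n, Measurable (ξ n)) (hindep : iIndepFun ξ μ)
    (hident : ∀ n, IdentDistrib (ξ n) (ξ 0) μ μ)
    (k p c : ℝ) (hk : 0 < k) (hc : 0 < c) (hp : 1 ≤ p / k)
    (hmoment : Integrable (fun ω => |ξ 0 ω| ^ k) μ)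
    (htail : Tendsto (fun u : ℝ => u ^ (-p) * Real.log (μ.real {ω | u ≤ |ξ 0 ω|}))
      atTop (𝓝 (-c)))
    (q : ℝ≥0∞) (hq : 1 / ENNReal.ofReal (p / k) + 1 / q = 1)
    (a b : ℕ → ℝ) (ha : ∀ n, 0 < a n) (hb : ∀ n, 0 < b n)
    (hasum : Summable (fun n => a n ^ (min 2 q).toReal))
    (hbsum : Summable (fun n => b n ^ (min 2 q).toReal))
    (haconv : ∀ᵐ ω ∂μ, Summable (fun n => a n * |ξ n ω| ^ k))
    (hbconv : ∀ᵐ ω ∂μ, Summable (fun n => b n * |ξ n ω| ^ k)) :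
    Tendsto (fun r : ℝ =>
        Real.log (μ.real {ω | r ≤ ∑' n, a n * |ξ n ω| ^ k}) /
          Real.log (μ.real {ω | r ≤ ∑' n, b n * |ξ n ω| ^ k}))
      atTop (𝓝 ((lqNorm q b / lqNorm q a) ^ (p / k))) ∧
    Tendsto (fun r : ℝ =>
        Real.log (μ.real {ω | r * lqNorm q a ≤ ∑' n, a n * |ξ n ω| ^ k}) /
          Real.log (μ.real {ω | r * lqNorm q b ≤ ∑' n, b n * |ξ n ω| ^ k}))
      atTop (𝓝 1) := by
  have hk1 : Measurable fun x : ℝ => |x| ^ k := by fun_prop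
  have hs0 : 0 < p / k := by linarith
  have hlim : ∀ d : ℕ → ℝ, (∀ n, 0 < d n) → Summable (fun n => d n ^ (min 2 q).toReal) →
      (∀ᵐ ω ∂μ, Summable (fun n => d n * |ξ n ω| ^ k)) → 0 < lqNorm q d ∧
      Tendsto (fun r : ℝ => r ^ (-(p / k)) *
        Real.log (μ.real {ω | r ≤ ∑' n, d n * |ξ n ω| ^ k})) atTop
        (𝓝 (-(c * (1 / lqNorm q d ^ (p / k))))) := fun d hd hdsum hdconv =>
    tendsto_log_measureReal_tsum_ge μ (Y := fun n ω => |ξ n ω| ^ k)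
      (fun n => hk1.comp (hmeas n)) (fun n ω => by positivity)
      (hindep.comp (fun _ x => |x| ^ k) fun _ => hk1) (fun n => (hident n).comp hk1) hp hc
      (tendsto_log_tail_abs_rpow μ hk htail) hq hd hdsum hdconv
  obtain ⟨hA, hLa⟩ := hlim a ha hasum haconv
  obtain ⟨hB, hLb⟩ := hlim b hb hbsum hbconv
  -- Measuring `r` in units of the norm removes the norm from the rate, hence the limit `1` in the
  -- second claim.
  have hscaled : ∀ {f : ℝ → ℝ} {N : ℝ}, 0 < N →
      Tendsto (fun r : ℝ => r ^ (-(p / k)) * f r) atTop (𝓝 (-(c * (1 / N ^ (p / k))))) →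
      Tendsto (fun r : ℝ => r ^ (-(p / k)) * f (r * N)) atTop (𝓝 (-c)) := by
    intro f N hN hf
    have h := (hf.comp (tendsto_id.atTop_mul_const hN)).const_mul (N ^ (p / k))
    have hNk : N ^ (p / k) ≠ 0 := by positivity
    have hval : N ^ (p / k) * -(c * (1 / N ^ (p / k))) = -c := by field_simp
    rw [hval] at h
    refine h.congr' ?_
    filter_upwards [eventually_ge_atTop 0] with r hr
    simp only [Function.comp_apply, id]
    rw [Real.mul_rpow hr hN.le, Real.rpow_neg hN.le]
    field_simp
  have hratio : ∀ {f g : ℝ → ℝ} {x y : ℝ}, y ≠ 0 →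
      Tendsto (fun r : ℝ => r ^ (-(p / k)) * f r) atTop (𝓝 x) →
      Tendsto (fun r : ℝ => r ^ (-(p / k)) * g r) atTop (𝓝 y) →
      Tendsto (fun r : ℝ => f r / g r) atTop (𝓝 (x / y)) := by
    intro f g x y hy hf hg
    refine (hf.div hg hy).congr' ?_
    filter_upwards [eventually_gt_atTop 0] with r hr
    exact mul_div_mul_left _ _ (Real.rpow_pos_of_pos hr _).ne'
  refine ⟨?_, ?_⟩
  · have hBk : 0 < lqNorm q b ^ (p / k) := by positivity
    convert hratio (by simp [hc.ne', hBk.ne']) hLa hLb using 2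
    rw [Real.div_rpow hB.le hA.le]
    field_simp
  · convert hratio (neg_ne_zero.2 hc.ne') (hscaled hA hLa) (hscaled hB hLb) using 2
    rw [div_self (neg_ne_zero.2 hc.ne')]
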